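/- Let $\Gamma$ be a countable discrete group, and let all vector spaces be taken over a fixed scalar field $\mathbb{K}$, which is either $\mathbb{R}$ or $\mathbb{C}$. We say that $\Gamma$ acts properly by affine isometries on a Banach space $V$ if there is a homomorphism $\alpha$ from $\Gamma$ to the group of bijective $\mathbb{K}$-affine isometries of $V$ such that, for every $v\in V$, $\|\alpha(g)v\|\to\infty$ as $g\to\infty$ in $\Gamma$ (that is, for every $R$ the set $\{g\in\Gamma : \|\alpha(g)v\|\le R\}$ is finite). The group $\Gamma$ is called a-T-menable if it acts properly by affine isometries on some Hilbert space. Then the following are equivalent: (i) $\Gamma$ is a-T-menable; (ii) for every real number $p\ge 1$ there is a measure space $(\Omega,\nu)$, which may depend on $p$, such that $\Gamma$ acts properly by affine isometries on $L^p(\Omega,\nu)$. -/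

import Mathlib

open Filter MeasureTheory
open scoped ENNReal

/-- The discrete group `Γ` acts properly by affine isometries on the normed space `E` over `𝕜`:
there is a homomorphism `α` from `Γ` to the group of (bijective) `𝕜`-affine isometries of `E` such
that, for every vector `v`, `‖α g v‖ → ∞` as `g → ∞`, that is, as `g` leaves every finite
subset of `Γ`. -/
def ActsProperlyByAffineIsometries (𝕜 : Type*) [NormedField 𝕜] (Γ : Type*) [Group Γ]
    (E : Type*) [NormedAddCommGroup E] [NormedSpace 𝕜 E] : Prop :=
  ∃ α : Γ →* (E ≃ᵃⁱ[𝕜] E), ∀ v : E, Tendsto (fun g : Γ => ‖α g v‖) cofinite atTop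

universe u v

/-- The discrete group `Γ` is a-T-menable (with `𝕜`, the real or the complex numbers, as scalars):
it acts properly by affine isometries on some Hilbert space. -/
def IsATMenable (𝕜 : Type) [RCLike 𝕜] (Γ : Type u) [Group Γ] : Prop :=
  ∃ (H : Type v) (_ : NormedAddCommGroup H) (_ : InnerProductSpace 𝕜 H) (_ : CompleteSpace H),
    ActsProperlyByAffineIsometries 𝕜 Γ H

/-- The discrete group `Γ` acts properly by affine isometries on `L^p(Ω, ν; 𝕜)` for some
measure space `(Ω, ν)`. -/
def ActsProperlyOnSomeLp (𝕜 : Type) [RCLike 𝕜] (Γ : Type u) [Group Γ] (p : ℝ≥0∞)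
    [Fact (1 ≤ p)] : Prop :=
  ∃ (Ω : Type v) (_ : MeasurableSpace Ω) (ν : Measure Ω),
    ActsProperlyByAffineIsometries 𝕜 Γ (Lp 𝕜 p ν)

open ProbabilityTheory
open scoped NNReal

/-! For (i) ⇒ (ii), let `b g = α g 0`, a cocycle for the linear part `π`, and take the centred
Gaussian process with covariance `⟪b g, b h⟫` (`exists_gaussian_measure`). As `b (k * h) - b k = π k
(b h)` and `π k` is isometric, the increments from `k` have the law of the process, so `Γ` acts on
path space preserving the measure. The coordinates form a cocycle in `L^p`, with norm a fixed
positive multiple of `‖b g‖`: properness survives for every finite `p`. Conversely, `L^2` is a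
Hilbert space. -/

/-- A finite measure on `ι → ℝ` is determined by the laws of the finite linear combinations of the
coordinates. -/
theorem measure_ext_of_map_linearCombination {ι : Type*} {μ ν : Measure (ι → ℝ)}
    [IsFiniteMeasure μ] [IsFiniteMeasure ν]
    (h : ∀ t : ι →₀ ℝ, μ.map (fun ω => Finsupp.linearCombination ℝ ω t) =
      ν.map (fun ω => Finsupp.linearCombination ℝ ω t)) : μ = ν := by
  classical
  refine IsProjectiveLimit.unique (P := fun I : Finset ι => ν.map I.restrict) (fun I => ?_)
    fun I => rfl
  have hr : Measurable (I.restrict : (ι → ℝ) → I → ℝ) := Finset.measurable_restrict I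
  -- Cramér–Wold: the characteristic function at `L` is that of the law of `L` at `1`.
  refine Measure.ext_of_charFunDual (funext fun L => ?_)
  rw [charFunDual_eq_charFun_map_one, charFunDual_eq_charFun_map_one,
    Measure.map_map (by fun_prop) hr, Measure.map_map (by fun_prop) hr]
  let t : ι →₀ ℝ := ∑ i : I, Finsupp.single (i : ι) (L (Pi.single i 1))
  have key : (L : (I → ℝ) → ℝ) ∘ (I.restrict : (ι → ℝ) → I → ℝ) =
      fun ω => Finsupp.linearCombination ℝ ω t := by
    funext ω
    have := L.toLinearMap.pi_apply_eq_sum_univ (I.restrict ω)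
    simp only [ContinuousLinearMap.coe_coe] at this
    simp only [Function.comp_apply, this, t, map_sum, Finsupp.linearCombination_single]
    refine Finset.sum_congr rfl fun i _ => ?_
    have h1 : (fun j : I => if i = j then (1 : ℝ) else 0) = Pi.single i 1 := by
      ext j; simp [Pi.single_apply, eq_comm]
    rw [h1, Finset.restrict, smul_eq_mul, smul_eq_mul, mul_comm]
  rw [key, h t]

theorem measurable_linearCombination {ι : Type*} (t : ι →₀ ℝ) :
    Measurable (fun ω : ι → ℝ => Finsupp.linearCombination ℝ ω t) := by
  simp only [Finsupp.linearCombination_apply, Finsupp.sum]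
  fun_prop

theorem infinitePi_gaussianReal_map_sum {J : Type*} (c : J → ℝ) (s : Finset J) :
    (Measure.infinitePi fun _ : J => gaussianReal 0 1).map (∑ i ∈ s, fun x : J → ℝ => c i * x i) =
      gaussianReal 0 (∑ i ∈ s, ‖c i‖₊ ^ 2) := by
  classical
  have hind : iIndepFun (fun (i : J) (x : J → ℝ) => c i * x i)
      (Measure.infinitePi fun _ : J => gaussianReal 0 1) :=
    iIndepFun_infinitePi (X := fun i (y : ℝ) => c i * y) (fun i => by fun_prop)
  induction s using Finset.induction_on with
  | empty =>
    have : (0 : (J → ℝ) → ℝ) = fun _ => 0 := rfl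
    simp [this, Measure.map_const]
  | insert i s hi ih =>
    rw [Finset.sum_insert hi, Finset.sum_insert hi]
    have h1 : (Measure.infinitePi fun _ : J => gaussianReal 0 1).map (fun x : J → ℝ => c i * x i) =
        gaussianReal 0 (‖c i‖₊ ^ 2) := by
      have := Measure.map_map (μ := Measure.infinitePi fun _ : J => gaussianReal 0 1)
        (g := fun y : ℝ => c i * y) (f := fun x : J → ℝ => x i) (by fun_prop) (by fun_prop)
      rw [Function.comp_def] at this
      rw [← this, Measure.infinitePi_map_eval, gaussianReal_map_const_mul, mul_zero, mul_one]
      congr 1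
      ext
      simp
    have h2 := (hind.indepFun_finsetSum_of_notMem (fun i => by fun_prop) hi).symm
    simpa using gaussianReal_add_gaussianReal_of_indepFun h2 h1 ih

theorem linearCombination_linearCombination {R : Type*} [CommSemiring R] {ι J M : Type*}
    [AddCommMonoid M] [Module R M] (y : J → M) (a : ι → J →₀ R) (t : ι →₀ R) :
    Finsupp.linearCombination R (fun g => Finsupp.linearCombination R y (a g)) t =
      Finsupp.linearCombination R y (Finsupp.linearCombination R a t) := by
  rw [Finsupp.apply_linearCombination]
  rfl

/-- Applied both to paths `ω` and to `b`, so that the two sides transform alike. -/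
theorem linearCombination_mul_left_sub {R : Type*} [CommRing R] {Γ M : Type*} [Mul Γ]
    [AddCommGroup M] [Module R M] (y : Γ → M) (k : Γ) (t : Γ →₀ R) :
    Finsupp.linearCombination R (fun h => y (k * h) - y k) t =
      Finsupp.linearCombination R y (t.mapDomain (k * ·) -
        Finsupp.single k (t.sum fun _ r => r)) := by
  rw [map_sub, Finsupp.linearCombination_mapDomain, Finsupp.linearCombination_single]
  simp only [Finsupp.linearCombination_apply, Finsupp.sum, smul_sub, Finset.sum_sub_distrib,
    Finset.sum_smul, Function.comp_apply]

/-- Any countable family `b` in a real inner product space is realized by a centred Gaussian process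
with covariance `⟪b i, b j⟫`. -/
theorem exists_gaussian_measure {H : Type*} [NormedAddCommGroup H] [InnerProductSpace ℝ H]
    {ι : Type*} [Countable ι] (b : ι → H) :
    ∃ ν : Measure (ι → ℝ), IsProbabilityMeasure ν ∧
      ∀ t : ι →₀ ℝ, ν.map (fun ω => Finsupp.linearCombination ℝ ω t) =
        gaussianReal 0 (‖Finsupp.linearCombination ℝ b t‖₊ ^ 2) := by
  classical
  obtain ⟨N, hN⟩ := Countable.exists_injective_nat ι
  let f : ℕ → H := Function.extend N b 0
  -- Gram–Schmidt gives `0` at dependent vectors; dropping these leaves an orthonormal family in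
  -- which each `b g` is a finite combination.
  let J := {i | InnerProductSpace.gramSchmidtNormed ℝ f i ≠ 0}
  let e : J → H := fun i => InnerProductSpace.gramSchmidtNormed ℝ f i
  have he : Orthonormal ℝ e := InnerProductSpace.gramSchmidtNormed_orthonormal' f
  have hb : ∀ g, b g ∈ Submodule.span ℝ (Set.range e) := by
    intro g
    have h1 : b g ∈ Submodule.span ℝ (Set.range f) :=
      Submodule.subset_span ⟨N g, hN.extend_apply _ _ _⟩
    rw [← InnerProductSpace.span_gramSchmidt ℝ, ← InnerProductSpace.span_gramSchmidtNormed_range]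
      at h1
    refine Submodule.span_le.2 ?_ h1
    rintro _ ⟨i, rfl⟩
    by_cases hi : InnerProductSpace.gramSchmidtNormed ℝ f i = 0
    · rw [hi]; exact Submodule.zero_mem _
    · exact Submodule.subset_span ⟨⟨i, hi⟩, rfl⟩
  choose a ha using fun g => (Finsupp.mem_span_range_iff_exists_finsupp.1 (hb g))
  let Φ : (J → ℝ) → ι → ℝ := fun x g => Finsupp.linearCombination ℝ x (a g)
  have hΦ : Measurable Φ := measurable_pi_lambda _ fun g => measurable_linearCombination _
  refine ⟨(Measure.infinitePi fun _ : J => gaussianReal 0 1).map Φ,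
    Measure.isProbabilityMeasure_map hΦ.aemeasurable, fun t => ?_⟩
  rw [Measure.map_map (measurable_linearCombination t) hΦ]
  set c : J →₀ ℝ := Finsupp.linearCombination ℝ a t with hc
  have h1 : (fun ω : ι → ℝ => Finsupp.linearCombination ℝ ω t) ∘ Φ =
      ∑ i ∈ c.support, fun x : J → ℝ => c i * x i := by
    funext x
    simp only [Function.comp_apply, Φ, Finset.sum_apply]
    rw [linearCombination_linearCombination, ← hc, Finsupp.linearCombination_apply]
    rfl
  have h2 : b = fun g => Finsupp.linearCombination ℝ e (a g) := by
    funext g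
    rw [Finsupp.linearCombination_apply, ha]
  rw [h1, infinitePi_gaussianReal_map_sum]
  congr 1
  ext
  have h3 : Finsupp.linearCombination ℝ b t = Finsupp.linearCombination ℝ e c := by
    rw [hc, h2, linearCombination_linearCombination]
  rw [h3]
  push_cast
  rw [← real_inner_self_eq_norm_sq, he.inner_finsupp_eq_sum_left]
  simp [Finsupp.sum, sq]

theorem affine_action_of_cocycle {𝕜 : Type*} [NormedField 𝕜] {Γ : Type*} [Group Γ]
    {E : Type*} [NormedAddCommGroup E] [NormedSpace 𝕜 E] (U : Γ → E →ₗᵢ[𝕜] E) (c : Γ → E)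
    (h1 : ∀ v, U 1 v = v) (hU : ∀ g h v, U (g * h) v = U g (U h v))
    (hc : ∀ g h, c (g * h) = U g (c h) + c g)
    (hp : Tendsto (fun g => ‖c g‖) cofinite atTop) : ActsProperlyByAffineIsometries 𝕜 Γ E := by
  have hc1 : c 1 = 0 := by simpa [h1] using hc 1 1
  let ρ : Γ → E ≃ₗᵢ[𝕜] E := fun g => LinearIsometryEquiv.ofSurjective (U g) fun v =>
    ⟨U g⁻¹ v, by rw [← hU, mul_inv_cancel, h1]⟩
  have hρ : ∀ g v, ρ g v = U g v := fun g v => rfl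
  let A : Γ → E ≃ᵃⁱ[𝕜] E := fun g =>
    AffineIsometryEquiv.mk' (fun v => U g v + c g) (ρ g) 0 (by simp [hρ])
  have hA : ∀ g v, A g v = U g v + c g := fun g v => rfl
  refine ⟨⟨⟨A, ?_⟩, ?_⟩, fun v => ?_⟩
  · ext v; simp [hA, h1, hc1]
  · intro g h; ext v; simp [hA, hU, hc, add_assoc]
  · refine tendsto_atTop_mono (fun g => ?_) (tendsto_atTop_add_const_right _ (-‖v‖) hp)
    change ‖c g‖ + -‖v‖ ≤ ‖A g v‖
    rw [hA, ← (U g).norm_map v]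
    have := norm_sub_le (U g v + c g) (U g v)
    rw [add_sub_cancel_left] at this
    linarith

theorem actsProperly_congr {𝕜 : Type*} [NormedField 𝕜] {Γ Δ : Type*} [Group Γ] [Group Δ]
    (e : Γ ≃* Δ) {E : Type*} [NormedAddCommGroup E] [NormedSpace 𝕜 E]
    (h : ActsProperlyByAffineIsometries 𝕜 Δ E) : ActsProperlyByAffineIsometries 𝕜 Γ E := by
  obtain ⟨α, hα⟩ := h
  exact ⟨α.comp e.toMonoidHom, fun v => (hα v).comp e.injective.tendsto_cofinite⟩

theorem memLp_of_map_eq_gaussianReal {Ω : Type*} [MeasurableSpace Ω] {ν : Measure Ω} {X : Ω → ℝ}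
    (hX : Measurable X) {v : ℝ≥0} (h : ν.map X = gaussianReal 0 v) {p : ℝ≥0∞} (hp : p ≠ ∞) :
    MemLp X p ν := by
  have := memLp_id_gaussianReal' (μ := 0) (v := v) p hp
  rw [← h] at this
  exact this.comp_of_map hX.aemeasurable

theorem eLpNorm_of_map_eq_gaussianReal {Ω : Type*} [MeasurableSpace Ω] {ν : Measure Ω}
    {X : Ω → ℝ} (hX : Measurable X) {r : ℝ≥0} (h : ν.map X = gaussianReal 0 (r ^ 2))
    (p : ℝ≥0∞) :
    (eLpNorm X p ν).toReal = r * (eLpNorm id p (gaussianReal 0 1)).toReal := by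
  have h2 : eLpNorm id p (ν.map X) = eLpNorm X p ν :=
    eLpNorm_map_measure measurable_id.aestronglyMeasurable hX.aemeasurable
  -- Scaling the standard Gaussian makes the norm linear in `r`.
  have h3 : gaussianReal 0 (r ^ 2) = (gaussianReal 0 1).map ((r : ℝ) * ·) := by
    rw [gaussianReal_map_const_mul]
    congr 1
    · simp
    · ext; simp
  have h4 : eLpNorm id p ((gaussianReal 0 1).map ((r : ℝ) * ·)) =
      eLpNorm ((r : ℝ) • (id : ℝ → ℝ)) p (gaussianReal 0 1) :=
    eLpNorm_map_measure measurable_id.aestronglyMeasurable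
      (measurable_const_mul (r : ℝ)).aemeasurable
  rw [← h2, h, h3, h4, eLpNorm_const_smul, ENNReal.toReal_mul]
  simp

theorem eLpNorm_id_gaussianReal_toReal_pos (p : ℝ≥0∞) [Fact (1 ≤ p)] (hp : p ≠ ∞) :
    0 < (eLpNorm id p (gaussianReal 0 1)).toReal := by
  have hp0 : p ≠ 0 := (zero_lt_one.trans_le Fact.out).ne'
  refine ENNReal.toReal_pos ?_ (memLp_id_gaussianReal' p hp).eLpNorm_ne_top
  rw [Ne, eLpNorm_eq_zero_iff measurable_id.aestronglyMeasurable hp0]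
  intro h
  have := nullSingletonClass_gaussianReal (μ := 0) (v := 1) one_ne_zero
  have h2 : gaussianReal 0 1 {x | ¬ x = 0} = 0 := h
  have h3 : gaussianReal 0 1 {(0 : ℝ)} = 0 := measure_singleton 0
  have h4 : gaussianReal 0 1 (Set.univ : Set ℝ) = 0 := by
    rw [← Set.union_compl_self {(0 : ℝ)}]
    exact measure_union_null h3 h2
  simp at h4

/-- A proper affine isometric action on a real inner product space, with cocycle `b`, yields one on
`L^p` of the Gaussian process with covariance `⟪b g, b h⟫`. The linear part is composition with the
measure preserving maps `ω ↦ (h ↦ ω (k * h) - ω k)`, and the cocycle is `g ↦ (ω ↦ ω g)`. -/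
theorem actsProperly_Lp {𝕜 : Type*} [RCLike 𝕜] {Γ : Type*} [Group Γ] [Countable Γ]
    {H : Type*} [NormedAddCommGroup H] [InnerProductSpace ℝ H] (π : Γ → H →ₗᵢ[ℝ] H) (b : Γ → H)
    (hb : ∀ g h, b (g * h) = π g (b h) + b g)
    (hp : Tendsto (fun g => ‖b g‖) cofinite atTop) (p : ℝ≥0∞) [Fact (1 ≤ p)] (hp' : p ≠ ∞) :
    ∃ ν : Measure (Γ → ℝ), ActsProperlyByAffineIsometries 𝕜 Γ (Lp 𝕜 p ν) := by
  obtain ⟨ν, hν, hlaw⟩ := exists_gaussian_measure b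
  refine ⟨ν, ?_⟩
  let T : Γ → (Γ → ℝ) → Γ → ℝ := fun k ω h => ω (k * h) - ω k
  have hTm : ∀ k, Measurable (T k) := fun k => by fun_prop
  have hT : ∀ k, MeasurePreserving (T k) ν ν := by
    intro k
    refine ⟨hTm k, ?_⟩
    have := Measure.isProbabilityMeasure_map (μ := ν) (hTm k).aemeasurable
    refine measure_ext_of_map_linearCombination fun t => ?_
    rw [Measure.map_map (measurable_linearCombination t) (hTm k), hlaw t]
    have h1 : (fun ω : Γ → ℝ => Finsupp.linearCombination ℝ ω t) ∘ T k =
        fun ω => Finsupp.linearCombination ℝ ω (t.mapDomain (k * ·) -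
          Finsupp.single k (t.sum fun _ r => r)) := funext fun ω => linearCombination_mul_left_sub ω k t
    have h2 : (fun h => b (k * h) - b k) = π k ∘ b := by
      funext h; simp [hb]
    have h3 : Finsupp.linearCombination ℝ (π k ∘ b) t = π k (Finsupp.linearCombination ℝ b t) :=
      (Finsupp.apply_linearCombination ℝ (π k).toLinearMap b t).symm
    have h4 := linearCombination_mul_left_sub b k t
    rw [h2] at h4
    rw [h1, hlaw, ← h4, h3, (π k).nnnorm_map]
  have heval : ∀ g, ν.map (fun ω => ω g) = gaussianReal 0 (‖b g‖₊ ^ 2) := by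
    intro g
    simpa using hlaw (Finsupp.single g 1)
  have hX : ∀ g, Measurable fun ω : Γ → ℝ => ω g := fun g => measurable_pi_apply g
  have hmem : ∀ g, MemLp (fun ω : Γ → ℝ => (ω g : 𝕜)) p ν := fun g =>
    (memLp_of_map_eq_gaussianReal (hX g) (heval g) hp').ofReal
  have hnorm : ∀ g, ‖(hmem g).toLp‖ = ‖b g‖ * (eLpNorm id p (gaussianReal 0 1)).toReal := by
    intro g
    rw [Lp.norm_toLp, ← coe_nnnorm, ← eLpNorm_of_map_eq_gaussianReal (hX g) (heval g) p]
    congr 1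
    exact eLpNorm_congr_norm_ae (.of_forall fun ω => by simp)
  have hpos := eLpNorm_id_gaussianReal_toReal_pos p hp'
  have hb1 : b 1 = 0 := by
    have := (π 1).norm_map (b 1)
    have h1 : b 1 = π 1 (b 1) + b 1 := by simpa using hb 1 1
    rwa [right_eq_add.1 h1, norm_zero, eq_comm, norm_eq_zero] at this
  -- Only almost everywhere: `ω 1` has variance `‖b 1‖ ^ 2 = 0`.
  have hT1 : T 1 =ᵐ[ν] id := by
    have h0 : ∀ᵐ x ∂(ν.map fun ω : Γ → ℝ => ω 1), x = 0 := by
      rw [heval, hb1]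
      simp [gaussianReal_zero_var]
    filter_upwards [ae_of_ae_map (hX 1).aemeasurable h0] with ω hω
    funext h
    simp [T, hω]
  refine affine_action_of_cocycle
    (fun g => Lp.compMeasurePreservingₗᵢ 𝕜 (T g) (hT g)) (fun g => (hmem g).toLp) ?_ ?_ ?_ ?_
  · intro v
    refine Lp.ext ((Lp.coeFn_compMeasurePreserving v (hT 1)).trans ?_)
    filter_upwards [hT1] with ω h
    rw [Function.comp_apply, h, id]
  · intro g h v
    -- `T` reverses products, and precomposition reverses them back.
    have h1 : T (g * h) = T h ∘ T g := by
      funext ω x; simp [T, mul_assoc]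
    change Lp.compMeasurePreserving (T (g * h)) (hT (g * h)) v = _
    simp only [h1]
    exact Lp.compMeasurePreserving_comp_apply v (hT h) (hT g)
  · intro g h
    change _ = Lp.compMeasurePreserving (T g) (hT g) _ + _
    rw [Lp.toLp_compMeasurePreserving, ← MemLp.toLp_add]
    congr 1
    funext ω
    simp [T]
  · simp only [hnorm]
    exact hp.atTop_mul_const hpos

theorem actsProperlyOnSomeLp_of_isATMenable {𝕜 : Type} [RCLike 𝕜] {Γ : Type u} [Group Γ]
    [Countable Γ] (h : IsATMenable.{u, v} 𝕜 Γ) (p : ℝ≥0∞) [Fact (1 ≤ p)] (hp : p ≠ ∞) :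
    ActsProperlyOnSomeLp.{u, v} 𝕜 Γ p := by
  obtain ⟨H, _, _, _, hact⟩ := h
  -- The path space must lie in universe `v`, so `Γ` is replaced by a copy there.
  have hsmall : Small.{v} Γ := Countable.toSmall Γ
  let e : Shrink.{v} Γ ≃* Γ := Shrink.mulEquiv
  have : Countable (Shrink.{v} Γ) := e.toEquiv.countable_iff.2 inferInstance
  obtain ⟨α, hα⟩ := actsProperly_congr e hact
  let _ : InnerProductSpace ℝ H := InnerProductSpace.rclikeToReal 𝕜 H
  obtain ⟨ν, hν⟩ := actsProperly_Lp (𝕜 := 𝕜) (Γ := Shrink.{v} Γ) (H := H)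
    (fun g =>
      { toFun := (α g).linearIsometryEquiv
        map_add' := map_add _
        map_smul' := fun r v => by
          change (α g).linearIsometryEquiv ((r : 𝕜) • v) = (r : 𝕜) • (α g).linearIsometryEquiv v
          exact map_smul _ _ _
        norm_map' := (α g).linearIsometryEquiv.norm_map })
    (fun g => α g 0)
    (fun g h => by
      have := (α g).map_vadd 0 (α h 0)
      simpa using this)
    (hα 0) p hp
  exact ⟨Shrink.{v} Γ → ℝ, inferInstance, ν, actsProperly_congr e.symm hν⟩

theorem mainTheorem7 (𝕜 : Type) [RCLike 𝕜] (Γ : Type u) [Group Γ] [Countable Γ] :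
    IsATMenable.{u, v} 𝕜 Γ ↔
      ∀ (p : ℝ≥0∞) [Fact (1 ≤ p)], p ≠ ∞ → ActsProperlyOnSomeLp.{u, v} 𝕜 Γ p := by
  refine ⟨fun h p _ hp => actsProperlyOnSomeLp_of_isATMenable h p hp, fun h => ?_⟩
  obtain ⟨Ω, _, ν, hν⟩ := h 2 ENNReal.ofNat_ne_top
  exact ⟨Lp 𝕜 2 ν, inferInstance, inferInstance, inferInstance, hν⟩
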